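/- For complex $\nu,\mu$ with $\nu+\mu+1\notin\{0,-1,-2,\dots\}$ and $z\in\mathbb C\setminus[-1,1]$ let $Q_\nu^\mu(z)$ be the associated Legendre function of the second kind, $$Q_\nu^\mu(z)=e^{i\pi\mu}\sqrt\pi\,2^\mu\,\Gamma(\nu+\mu+1)\,\frac{(z^2-1)^{\mu/2}}{\bigl(z+\sqrt{z^2-1}\bigr)^{\nu+\mu+1}}\;\frac{1}{\Gamma(\nu+\frac32)}\,{}_2F_1\!\left(\mu+\tfrac12,\ \nu+\mu+1;\ \nu+\tfrac32;\ \frac{z-\sqrt{z^2-1}}{z+\sqrt{z^2-1}}\right),$$ where ${}_2F_1(a,b;c;x)/\Gamma(c)=\sum_{n\ge0}\frac{(a)_n(b)_n}{\Gamma(c+n)\,n!}x^n$ is the regularized hypergeometric series (for $|z|>1$ this is the same function as $e^{i\pi\mu}\sqrt\pi\,\Gamma(\nu+\mu+1)\frac{(z^2-1)^{\mu/2}}{2^{\nu+1}z^{\nu+\mu+1}}\frac{1}{\Gamma(\nu+3/2)}{}_2F_1(\frac{\nu+\mu+2}2,\frac{\nu+\mu+1}2;\nu+\frac32;z^{-2})$).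 All powers are principal, $(z^2-1)^s$ means $(z-1)^s(z+1)^s$, and $\sqrt{z^2-1}=(z^2-1)^{1/2}$; on the branch cut $(-\infty,-1)$ this gives the limiting values from the upper half plane. Write $Q_\nu=Q_\nu^0$ and $\psi=\Gamma'/\Gamma$. Let $z\in\mathbb C\setminus[-1,1]$, $m\in\mathbb N_0$, and let $\nu\in\mathbb C$ be such that $\nu-m+\frac12\notin\{0,-1,-2,\dots\}$. Then $\mu\mapsto Q_{\nu-1/2}^\mu(z)$ is complex differentiable at $\mu=m$ and at $\mu=-m$, and, with either the upper or the lower signs throughout, $$\frac{\Gamma(\nu\mp m+\frac12)}{\Gamma(\nu-m+\frac12)}\left[\frac{\partial}{\partial\mu}Q_{\nu-1/2}^\mu(z)\right]_{\mu=\pm m}=\left[i\pi+\psi\left(\nu\mp m+\tfrac12\right)\right]Q_{\nu-1/2}^m(z)\pm m!\sum_{k=0}^{m-1}\frac{(-1)^{k-m}(z^2-1)^{(k-m)/2}}{k!\,(m-k)\,2^{k-m+1}}\,Q_{\nu+k-m-1/2}^k(z).$$ In particular, if $\nu+\frac12\notin\{0,-1,-2,\dots\}$, then $$\left[\frac{\partial}{\partial\mu}Q_{\nu-1/2}^\mu(z)\right]_{\mu=0}=\left[i\pi+\psi\left(\nu+\tfrac12\right)\right]Q_{\nu-1/2}(z),$$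 and, if $\nu-\frac12\notin\{0,-1,-2,\dots\}$, then $$\left(\nu^2-\tfrac14\right)\left[\frac{\partial}{\partial\mu}Q_{\nu-1/2}^\mu(z)\right]_{\mu=-1}=\left[i\pi+\psi\left(\nu+\tfrac32\right)\right]Q_{\nu-1/2}^1(z)+(z^2-1)^{-1/2}Q_{\nu-3/2}(z),$$ $$\left[\frac{\partial}{\partial\mu}Q_{\nu-1/2}^\mu(z)\right]_{\mu=1}=\left[i\pi+\psi\left(\nu-\tfrac12\right)\right]Q_{\nu-1/2}^1(z)-(z^2-1)^{-1/2}Q_{\nu-3/2}(z).$$ -/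

import Mathlib

/-- Olver's regularized Gauss hypergeometric series
`F(a, b; c; x) / Γ(c) = ∑ₙ (a)ₙ (b)ₙ / (Γ(c + n) n!) xⁿ` for `|x| < 1`. It makes sense for all complex
`a`, `b`, `c`: Mathlib's `Gamma` takes the value `0` at its poles, so that `(Gamma (c + n))⁻¹` is
the entire function `1 / Γ(c + n)` there too. -/
noncomputable def regHypergeometric (a b c x : ℂ) : ℂ :=
  ∑' n : ℕ, (ascPochhammer ℂ n).eval a * (ascPochhammer ℂ n).eval b *
    (Complex.Gamma (c + n))⁻¹ * ((n.factorial : ℂ))⁻¹ * x ^ n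

/-- The power `(z² - 1)^s` in the convention of the theory of Legendre functions, namely
`(z - 1)^s (z + 1)^s` with principal powers; it is analytic in `ℂ ∖ (-∞, 1]`, positive for `z > 1`
and real `s`, and on the cut `(-∞, -1)` it is the limit from the upper half plane. -/
noncomputable def sqSubOnePow (z s : ℂ) : ℂ := (z - 1) ^ s * (z + 1) ^ s

/-- The associated Legendre function of the second kind `Q_ν^μ(z)` of degree `ν` and order `μ`, in
Hobson's normalization, for `z ∈ ℂ ∖ [-1, 1]`:
`Q_ν^μ(z) = e^{iπμ} √π 2^μ Γ(ν + μ + 1) (z² - 1)^{μ/2} (z + √(z² - 1))^{-ν-μ-1}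
  F(μ + 1/2, ν + μ + 1; ν + 3/2; (z - √(z² - 1)) / (z + √(z² - 1))) / Γ(ν + 3/2)`.
The argument of `F` has modulus less than one exactly when `z ∉ [-1, 1]` (it is `e^{-2ζ}` for
`z = cosh ζ`, `Re ζ > 0`), so this one series gives `Q_ν^μ` on its whole domain. For `|z| > 1` it
is the quadratic transform of the series
`e^{iπμ} √π Γ(ν + μ + 1) (z² - 1)^{μ/2} / (2^{ν+1} z^{ν+μ+1})
  F((ν + μ + 2)/2, (ν + μ + 1)/2; ν + 3/2; 1/z²) / Γ(ν + 3/2)`.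
The function has its usual branch cut along `(-∞, 1]`; on `(-∞, -1)` its value is the limit from
the upper half plane. It is meaningful unless `ν + μ + 1` is a pole of `Γ`. -/
noncomputable def legendreQ (ν μ z : ℂ) : ℂ :=
  Complex.exp (Complex.I * Real.pi * μ) * (Real.sqrt Real.pi : ℂ) * (2 : ℂ) ^ μ *
    Complex.Gamma (ν + μ + 1) * sqSubOnePow z (μ / 2) *
    (z + sqSubOnePow z (1 / 2)) ^ (-(ν + μ + 1)) *
    regHypergeometric (μ + 1 / 2) (ν + μ + 1) (ν + 3 / 2)
      ((z - sqSubOnePow z (1 / 2)) / (z + sqSubOnePow z (1 / 2)))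

/-- The finite sum in the order derivative of `Q_{ν-1/2}^μ(z)` at `μ = ±m`, without its sign:
`m! ∑_{k=0}^{m-1} (-1)^{k-m} (z² - 1)^{(k-m)/2} / (k! (m - k) 2^{k-m+1}) Q_{ν+k-m-1/2}^k(z)`. -/
noncomputable def orderDerivSum (m : ℕ) (ν z : ℂ) : ℂ :=
  (m.factorial : ℂ) * ∑ k ∈ Finset.range m,
    (-1 : ℂ) ^ ((k : ℤ) - m) * sqSubOnePow z (((k : ℂ) - m) / 2) /
      ((k.factorial : ℂ) * ((m : ℂ) - k) * (2 : ℂ) ^ ((k : ℤ) - m + 1)) *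
      legendreQ (ν + k - m - 1 / 2) k z

/-! Write `r = √(z² - 1)` and `Q_ν^μ = e^{iπμ} Γ(ν + μ + 1) R(μ)`. The reduced function `R` is
entire and even in `μ`: entire because the regularized series converges locally uniformly in its
parameters (`differentiable_legendreQReduced`), even because Euler's transformation
(`regHypergeometric_euler`) turns the series for `μ` into the one for `-μ` (`legendreQReduced_neg`).
Differentiating the prefactor gives `iπ + ψ(ν + μ + 1)`, so only `R'(±m)` has to be found.

Evenness gives `R'(0) = 0`, which is the case `m = 0`. For larger `m` the recurrence `r Q_ν^{μ+1} =
(ν - μ) z Q_ν^μ - (ν + μ) Q_{ν-1}^μ` (`legendreQ_order_succ`, a contiguous relation in disguise) is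
differentiated at `μ = m`. Differentiating its coefficients produces `-z Q_ν^m - Q_{ν-1}^m`. The
first term is cancelled by `ψ(x + 1) = ψ(x) + 1/x`; the second is the inhomogeneity in the
recurrence of the finite sum (`orderDerivSum_succ`).

At `-m` no new induction is needed: `R'` is odd, so the known value of `R'(m)` determines `R'(-m)`.
This exchanges the two digamma values and reverses the sign of the sum. -/

open Filter Topology Polynomial

/-! ### Regularized hypergeometric series: convergence and dependence on parameters -/

/-- The `n`-th term of the regularized hypergeometric series. -/
noncomputable def regHypergeometricTerm (a b c x : ℂ) (n : ℕ) : ℂ :=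
  (ascPochhammer ℂ n).eval a * (ascPochhammer ℂ n).eval b *
    (Complex.Gamma (c + n))⁻¹ * ((n.factorial : ℂ))⁻¹ * x ^ n

theorem regHypergeometric_eq_tsum (a b c x : ℂ) :
    regHypergeometric a b c x = ∑' n, regHypergeometricTerm a b c x n := rfl

theorem regHypergeometric_swap (a b c x : ℂ) :
    regHypergeometric a b c x = regHypergeometric b a c x := by
  simp only [regHypergeometric, mul_comm ((ascPochhammer ℂ _).eval a)]

theorem inv_Gamma_add_natCast (c : ℂ) (n : ℕ) :
    (Complex.Gamma (c + n))⁻¹ = (c + n) * (Complex.Gamma (c + (n + 1 : ℕ)))⁻¹ := by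
  rw [Complex.one_div_Gamma_eq_self_mul_one_div_Gamma_add_one (c + n)]
  push_cast
  rw [add_assoc]

/-- A majorant of the terms of the regularized hypergeometric series, uniform for `‖a‖ ≤ A` and
`‖b‖ ≤ B`. -/
noncomputable def regHypergeometricMajorant (A B : ℝ) (c x : ℂ) (n : ℕ) : ℝ :=
  (ascPochhammer ℝ n).eval A * (ascPochhammer ℝ n).eval B *
    ‖(Complex.Gamma (c + n))⁻¹‖ * ((n.factorial : ℝ))⁻¹ * ‖x‖ ^ n

theorem norm_ascPochhammer_eval_le {a : ℂ} {A : ℝ} (ha : ‖a‖ ≤ A) (n : ℕ) :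
    ‖(ascPochhammer ℂ n).eval a‖ ≤ (ascPochhammer ℝ n).eval A := by
  induction n with
  | zero => simp
  | succ n ih =>
    rw [ascPochhammer_succ_eval, ascPochhammer_succ_eval, norm_mul]
    gcongr
    · exact (norm_nonneg _).trans ih
    · calc ‖a + n‖ ≤ ‖a‖ + ‖(n : ℂ)‖ := norm_add_le _ _
        _ ≤ A + n := by simpa using ha

theorem norm_regHypergeometricTerm_le {a b : ℂ} {A B : ℝ} (ha : ‖a‖ ≤ A) (hb : ‖b‖ ≤ B)
    (c x : ℂ) (n : ℕ) :
    ‖regHypergeometricTerm a b c x n‖ ≤ regHypergeometricMajorant A B c x n := by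
  have h1 := norm_ascPochhammer_eval_le ha n
  have h2 := norm_ascPochhammer_eval_le hb n
  have h3 := (norm_nonneg _).trans h1
  simp only [regHypergeometricTerm, regHypergeometricMajorant, norm_mul, norm_pow]
  rw [norm_inv (n.factorial : ℂ), Complex.norm_natCast]
  gcongr

/-- Ratio test: since `|c + n| ≥ n - |c|`, the recurrence of `1/Γ` bounds the ratio of consecutive
terms by a quantity tending to `|x| < 1`. -/
theorem summable_regHypergeometricMajorant {A B : ℝ} (hA : 0 < A) (hB : 0 < B) (c : ℂ) {x : ℂ}
    (hx : ‖x‖ < 1) : Summable (regHypergeometricMajorant A B c x) := by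
  obtain ⟨r, hxr, hr⟩ := exists_between hx
  have hn : Tendsto (fun n : ℕ => (n : ℝ)) atTop atTop := tendsto_natCast_atTop_atTop
  have hlim : Tendsto (fun n : ℕ => ((A + n) / (n + 1)) * ((B + n) / (n - ‖c‖)) * ‖x‖) atTop
      (𝓝 (1 * 1 * ‖x‖)) := by
    have key : ∀ p q : ℝ, Tendsto (fun n : ℕ => (p + n) / ((n : ℝ) + q)) atTop (𝓝 1) := by
      intro p q
      have h1 : Tendsto (fun n : ℕ => 1 + (p - q) * ((n : ℝ) + q)⁻¹) atTop (𝓝 (1 + (p - q) * 0)) :=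
        ((tendsto_inv_atTop_zero.comp (tendsto_atTop_add_const_right _ q hn)).const_mul _).const_add _
      rw [mul_zero, add_zero] at h1
      refine h1.congr' ?_
      filter_upwards [hn.eventually_gt_atTop (-q)] with n h
      have : (n : ℝ) + q ≠ 0 := by linarith
      field_simp
      ring
    exact ((key A 1).mul (by simpa [sub_eq_add_neg] using key B (-‖c‖))).mul_const _
  refine summable_of_ratio_norm_eventually_le hr ?_
  have hev := hlim.eventually_lt_const (show 1 * 1 * ‖x‖ < r by simpa using hxr)
  filter_upwards [hev, hn.eventually_gt_atTop ‖c‖] with n h1 h2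
  have hpos : ∀ C : ℝ, 0 < C → 0 < (ascPochhammer ℝ n).eval C := fun C hC => ascPochhammer_pos n C hC
  have hnc : 0 < (n : ℝ) - ‖c‖ := by linarith
  have hg : ‖(Complex.Gamma (c + (n + 1 : ℕ)))⁻¹‖ ≤ ‖(Complex.Gamma (c + n))⁻¹‖ / (n - ‖c‖) := by
    rw [le_div_iff₀ hnc, inv_Gamma_add_natCast c n, norm_mul, mul_comm]
    gcongr
    have := norm_sub_le (c + n) c
    simp only [add_sub_cancel_left, Complex.norm_natCast] at this
    linarith
  have hnn : ∀ k, 0 ≤ regHypergeometricMajorant A B c x k := fun k => by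
    have h1 := ascPochhammer_pos k A hA
    have h2 := ascPochhammer_pos k B hB
    unfold regHypergeometricMajorant
    positivity
  rw [Real.norm_of_nonneg (hnn _), Real.norm_of_nonneg (hnn _)]
  calc regHypergeometricMajorant A B c x (n + 1)
      ≤ ((ascPochhammer ℝ n).eval A * (A + n)) * ((ascPochhammer ℝ n).eval B * (B + n)) *
        (‖(Complex.Gamma (c + n))⁻¹‖ / (n - ‖c‖)) * (((n + 1).factorial : ℝ))⁻¹ * ‖x‖ ^ (n + 1) := by
        have h1 := hpos A hA
        have h2 := hpos B hB
        rw [regHypergeometricMajorant, ascPochhammer_succ_eval, ascPochhammer_succ_eval]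
        gcongr
    _ = (((A + n) / (n + 1)) * ((B + n) / (n - ‖c‖)) * ‖x‖) * regHypergeometricMajorant A B c x n := by
        rw [regHypergeometricMajorant, Nat.factorial_succ]
        push_cast
        field_simp
        ring
    _ ≤ r * regHypergeometricMajorant A B c x n := by gcongr; exact hnn n

theorem summable_norm_regHypergeometricTerm (a b c : ℂ) {x : ℂ} (hx : ‖x‖ < 1) :
    Summable fun n => ‖regHypergeometricTerm a b c x n‖ :=
  Summable.of_nonneg_of_le (fun _ => norm_nonneg _)
    -- The added `1` only makes the bounds strictly positive.
    (norm_regHypergeometricTerm_le (A := ‖a‖ + 1) (B := ‖b‖ + 1) (by linarith) (by linarith) c x)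
    (summable_regHypergeometricMajorant (by positivity) (by positivity) c hx)

theorem summable_regHypergeometricTerm (a b c : ℂ) {x : ℂ} (hx : ‖x‖ < 1) :
    Summable (regHypergeometricTerm a b c x) :=
  (summable_norm_regHypergeometricTerm a b c hx).of_norm

/-- Weierstrass: on each ball of `μ` the terms are polynomials in `μ` dominated by one summable
majorant. -/
theorem differentiable_regHypergeometric_add (a b c : ℂ) {x : ℂ} (hx : ‖x‖ < 1) :
    Differentiable ℂ fun μ => regHypergeometric (μ + a) (μ + b) c x := by
  intro μ₀
  have hμ : ∀ {μ : ℂ}, μ ∈ Metric.ball (0 : ℂ) (‖μ₀‖ + 1) → ∀ d : ℂ,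
      ‖μ + d‖ ≤ ‖μ₀‖ + 1 + ‖d‖ := fun h d => by
    have := norm_add_le _ d |>.trans (add_le_add_left (mem_ball_zero_iff.1 h).le ‖d‖)
    exact this
  have h : DifferentiableOn ℂ (fun μ => ∑' n, regHypergeometricTerm (μ + a) (μ + b) c x n)
      (Metric.ball 0 (‖μ₀‖ + 1)) := by
    refine Complex.differentiableOn_tsum_of_summable_norm
      (summable_regHypergeometricMajorant (A := ‖μ₀‖ + 1 + ‖a‖) (B := ‖μ₀‖ + 1 + ‖b‖)
        (by positivity) (by positivity) c hx) (fun n => ?_) Metric.isOpen_ball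
      (fun n μ h => norm_regHypergeometricTerm_le (hμ h a) (hμ h b) c x n)
    have hp : ∀ d : ℂ, Differentiable ℂ fun μ : ℂ => (ascPochhammer ℂ n).eval (μ + d) :=
      fun d => (ascPochhammer ℂ n).differentiable.comp (differentiable_id.add_const d)
    exact (((((hp a).mul (hp b)).mul_const _).mul_const _).mul_const _).differentiableOn
  exact h.differentiableAt (Metric.isOpen_ball.mem_nhds (by simp))

/-! ### The Pfaff–Saalschütz identity and Euler's transformation -/

theorem ascPochhammer_succ_eval_left (n : ℕ) (a : ℂ) :
    (ascPochhammer ℂ (n + 1)).eval a = a * (ascPochhammer ℂ n).eval (a + 1) := by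
  rw [ascPochhammer_succ_left]
  simp

/-- The partial sums of a telescoping series behind the Pfaff–Saalschütz identity. -/
theorem sum_range_saalschutz_telescope (α β c : ℂ) (n K : ℕ) (hK : K ≤ n) :
    ∑ k ∈ Finset.range K, (n.choose k : ℂ) * ((ascPochhammer ℂ (n - k)).eval (c - α - β) *
        ((ascPochhammer ℂ k).eval α * (ascPochhammer ℂ k).eval β)) *
      ((c - α - β + (n - k)) * (c + n) * (ascPochhammer ℂ (n - k)).eval (c + k) +
        (α + k) * (β + k) * (ascPochhammer ℂ (n - k)).eval (c + k + 1) -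
        (c - α + n) * (c - β + n) * (ascPochhammer ℂ (n - k)).eval (c + k)) =
      K * n.choose K * (ascPochhammer ℂ (n - K + 1)).eval (c - α - β) *
        (ascPochhammer ℂ (n - K)).eval (c + K) *
        ((ascPochhammer ℂ K).eval α * (ascPochhammer ℂ K).eval β) := by
  induction K with
  | zero => simp
  | succ K ih =>
    obtain ⟨j, rfl⟩ := Nat.exists_eq_add_of_le hK
    have hc : ((K + 1 + j).choose (K + 1) : ℂ) * (K + 1) = (K + 1 + j).choose K * (j + 1) := by
      have := Nat.choose_succ_right_eq (K + 1 + j) K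
      rw [show K + 1 + j - K = j + 1 by omega] at this
      exact_mod_cast this
    rw [Finset.sum_range_succ, ih (by omega), show K + 1 + j - K = j + 1 by omega,
      show K + 1 + j - (K + 1) = j by omega, ascPochhammer_succ_eval K α, ascPochhammer_succ_eval K β,
      ascPochhammer_succ_eval_left j (c + K), ascPochhammer_succ_eval (j + 1) (c - α - β),
      ascPochhammer_succ_eval j (c + K + 1)]
    push_cast
    rw [show c + ((K : ℂ) + 1) = c + K + 1 by ring]
    linear_combination -((ascPochhammer ℂ (j + 1)).eval (c - α - β) *
      (ascPochhammer ℂ j).eval (c + K + 1) * ((ascPochhammer ℂ K).eval α * (α + K) *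
      ((ascPochhammer ℂ K).eval β * (β + K)))) * hc

/-- A polynomial form of the **Pfaff–Saalschütz identity**. -/
theorem sum_antidiagonal_saalschutz (α β c : ℂ) (n : ℕ) :
    ∑ p ∈ Finset.HasAntidiagonal.antidiagonal n, (n.choose p.1 : ℂ) *
      ((ascPochhammer ℂ p.2).eval (c - α - β) * (ascPochhammer ℂ p.2).eval (c + p.1) *
        ((ascPochhammer ℂ p.1).eval α * (ascPochhammer ℂ p.1).eval β)) =
      (ascPochhammer ℂ n).eval (c - α) * (ascPochhammer ℂ n).eval (c - β) := by
  induction n with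
  | zero => simp
  | succ n ih =>
    have htel : ∑ p ∈ Finset.HasAntidiagonal.antidiagonal n, (n.choose p.1 : ℂ) *
        ((ascPochhammer ℂ p.2).eval (c - α - β) *
        ((ascPochhammer ℂ p.1).eval α * (ascPochhammer ℂ p.1).eval β)) *
        ((c - α - β + p.2) * (c + n) * (ascPochhammer ℂ p.2).eval (c + p.1) +
        (α + p.1) * (β + p.1) * (ascPochhammer ℂ p.2).eval (c + p.1 + 1) -
        (c - α + n) * (c - β + n) * (ascPochhammer ℂ p.2).eval (c + p.1)) = 0 := by
      rw [Finset.Nat.sum_antidiagonal_eq_sum_range_succ (fun i j => (n.choose i : ℂ) *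
        ((ascPochhammer ℂ j).eval (c - α - β) *
        ((ascPochhammer ℂ i).eval α * (ascPochhammer ℂ i).eval β)) *
        ((c - α - β + j) * (c + n) * (ascPochhammer ℂ j).eval (c + i) +
        (α + i) * (β + i) * (ascPochhammer ℂ j).eval (c + i + 1) -
        (c - α + n) * (c - β + n) * (ascPochhammer ℂ j).eval (c + i))) n, Finset.sum_range_succ]
      -- The closed form is available only for `K ≤ n`; the remaining term `k = n` equals `-n (c - α
      -- - β) (α)ₙ (β)ₙ` and cancels it.
      have h := sum_range_saalschutz_telescope α β c n n le_rfl
      have h' : ∀ k ∈ Finset.range n, ((n - k : ℕ) : ℂ) = n - k := fun k hk =>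
        Nat.cast_sub (Finset.mem_range.1 hk).le
      rw [Finset.sum_congr rfl fun k hk => by rw [h' k hk], h]
      simp
      ring
    -- Pascal's rule splits the sum for `n + 1` into two sums over the antidiagonal of `n`;
    -- subtracting `(c - α + n)(c - β + n)` times the sum for `n` leaves the telescoping sum.
    rw [Finset.sum_antidiagonal_choose_succ_mul (R := ℂ) (fun i j =>
      ((ascPochhammer ℂ j).eval (c - α - β) * (ascPochhammer ℂ j).eval (c + i) *
        ((ascPochhammer ℂ i).eval α * (ascPochhammer ℂ i).eval β))) n,
      ascPochhammer_succ_eval, ascPochhammer_succ_eval,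
      show (ascPochhammer ℂ n).eval (c - α) * (c - α + n) *
        ((ascPochhammer ℂ n).eval (c - β) * (c - β + n)) = (c - α + n) * (c - β + n) *
        ((ascPochhammer ℂ n).eval (c - α) * (ascPochhammer ℂ n).eval (c - β)) by ring, ← ih,
      Finset.mul_sum, ← sub_eq_zero, ← Finset.sum_add_distrib, ← Finset.sum_sub_distrib, ← htel]
    refine Finset.sum_congr rfl fun p hp => ?_
    obtain ⟨i, j⟩ := p
    obtain rfl : i + j = n := Finset.HasAntidiagonal.mem_antidiagonal.1 hp
    simp only [ascPochhammer_succ_eval]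
    rw [show (i + j).choose j = (i + j).choose i from by rw [Nat.choose_symm_add]]
    push_cast
    rw [show c + ((i : ℂ) + 1) = c + i + 1 by ring]
    ring

theorem inv_Gamma_add_natCast_mul (c : ℂ) (i j : ℕ) :
    (Complex.Gamma (c + i))⁻¹ =
      (ascPochhammer ℂ j).eval (c + i) * (Complex.Gamma (c + (i + j : ℕ)))⁻¹ := by
  induction j with
  | zero => simp
  | succ j ih =>
    rw [ih, inv_Gamma_add_natCast c (i + j), ascPochhammer_succ_eval]
    push_cast
    simp only [← add_assoc]
    ring

/-- The binomial series as a regularized hypergeometric series. -/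
theorem regHypergeometric_one_one (a : ℂ) {x : ℂ} (hx : ‖x‖ < 1) :
    regHypergeometric a 1 1 x = (1 - x) ^ (-a) := by
  have h := (Complex.one_div_one_sub_cpow_hasFPowerSeriesOnBall_zero a).hasSum
    (y := x) (by simpa [enorm_eq_nnnorm, ← NNReal.coe_lt_coe] using hx)
  rw [Complex.cpow_neg, ← one_div]
  simp only [zero_add] at h
  rw [← h.tsum_eq, regHypergeometric]
  refine tsum_congr fun n => ?_
  have hf : (n.factorial : ℂ) ≠ 0 := by exact_mod_cast n.factorial_ne_zero
  have h1 : (ascPochhammer ℂ n).eval (1 : ℂ) = n.factorial := by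
    simp
  have h2 : Complex.Gamma (1 + n) = n.factorial := by
    rw [add_comm, Complex.Gamma_nat_eq_factorial]
  have h3 : (n.factorial : ℂ) * Ring.choose (a + n - 1) n = (ascPochhammer ℂ n).eval a := by
    rw [← nsmul_eq_mul, ← Ring.descPochhammer_eq_factorial_smul_choose,
      Polynomial.descPochhammer_smeval_eq_ascPochhammer, Polynomial.ascPochhammer_smeval_cast,
      Polynomial.ascPochhammer_smeval_eq_eval]
    congr 1
    ring
  rw [h1, h2, ← h3]
  have hp : (FormalMultilinearSeries.ofScalars ℂ (fun n : ℕ => Ring.choose (a + n - 1) n) n)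
      (fun _ => x) = Ring.choose (a + n - 1) n * x ^ n := by
    simp [FormalMultilinearSeries.ofScalars]
  rw [hp]
  field_simp

/-- **Euler's transformation** of the regularized hypergeometric series. -/
theorem regHypergeometric_euler (a b c : ℂ) {x : ℂ} (hx : ‖x‖ < 1) :
    regHypergeometric a b c x =
      (1 - x) ^ (c - a - b) * regHypergeometric (c - a) (c - b) c x := by
  rw [show c - a - b = -(a + b - c) by ring, ← regHypergeometric_one_one _ hx,
    regHypergeometric_eq_tsum (a + b - c), regHypergeometric_eq_tsum (c - a),
    mul_comm, tsum_mul_tsum_eq_tsum_sum_antidiagonal_of_summable_norm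
      (summable_norm_regHypergeometricTerm _ _ _ hx)
      (summable_norm_regHypergeometricTerm _ _ _ hx)]
  refine tsum_congr fun n => ?_
  -- Coefficient of `xⁿ` in the Cauchy product with the binomial series: Saalschütz for `α = c - a`,
  -- `β = c - b`, where `c - α - β = a + b - c`.
  have hs := sum_antidiagonal_saalschutz (c - a) (c - b) c n
  simp only [sub_sub_cancel] at hs
  rw [hs.symm, Finset.sum_mul, Finset.sum_mul, Finset.sum_mul]
  refine Finset.sum_congr rfl fun p hp => ?_
  obtain ⟨i, j⟩ := p
  obtain rfl : i + j = n := Finset.HasAntidiagonal.mem_antidiagonal.1 hp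
  have hi : (i.factorial : ℂ) ≠ 0 := by exact_mod_cast i.factorial_ne_zero
  have hj : (j.factorial : ℂ) ≠ 0 := by exact_mod_cast j.factorial_ne_zero
  have hij : ((i + j).factorial : ℂ) ≠ 0 := by exact_mod_cast (i + j).factorial_ne_zero
  have hch : ((i + j).choose i : ℂ) * i.factorial * j.factorial = (i + j).factorial := by
    rw [Nat.choose_symm_add]
    exact_mod_cast Nat.add_choose_mul_factorial_mul_factorial i j
  have h1 : (ascPochhammer ℂ j).eval (1 : ℂ) = j.factorial := by
    simp
  have h2 : Complex.Gamma (1 + j) = j.factorial := by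
    rw [add_comm, Complex.Gamma_nat_eq_factorial]
  simp only [regHypergeometricTerm]
  rw [h1, h2, inv_Gamma_add_natCast_mul c i j, pow_add, ← hch,
    show a - (c - b) = a + b - c by ring]
  have hc0 : ((i + j).choose i : ℂ) ≠ 0 := by
    intro h0; rw [h0] at hch; simp at hch; exact hij hch.symm
  field_simp

/-! ### A contiguous relation -/

/-- A contiguous relation of the regularized hypergeometric series, on the two-parameter family
that occurs in the Legendre functions of the second kind. -/
theorem regHypergeometric_contiguous (a c : ℂ) {x : ℂ} (hx : ‖x‖ < 1) :
    -((1 - x) ^ 2 * (a + c - 1) * regHypergeometric (a + 1) (a + c) c x) =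
      (c - a - 1) * (1 + x) * regHypergeometric a (a + c - 1) c x -
        2 * regHypergeometric a (a + c - 2) (c - 1) x := by
  set V := regHypergeometricTerm (a + 1) (a + c) c x with hV
  set U := regHypergeometricTerm a (a + c - 1) c x with hU
  set Y := regHypergeometricTerm a (a + c - 2) (c - 1) x with hY
  have sV : Summable V := summable_regHypergeometricTerm _ _ _ hx
  have sU : Summable U := summable_regHypergeometricTerm _ _ _ hx
  have sY : Summable Y := summable_regHypergeometricTerm _ _ _ hx
  have tail : ∀ {f : ℕ → ℂ}, Summable f → ∑' n, f (n + 1) = ∑' n, f n - f 0 := fun hf => by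
    rw [hf.tsum_eq_zero_add]; ring
  have shift : ∀ {f : ℕ → ℂ}, Summable f → Summable fun n => f (n + 1) := fun hf =>
    (summable_nat_add_iff 1).2 hf
  have hg := inv_Gamma_add_natCast c
  -- With `(1 - x)²` expanded, the relation is checked power by power: `e0`, `e1`, `e2` are the
  -- terms in `x⁰`, `x¹` and `x^{n+2}`.
  have e0 : -((a + c - 1) * V 0) = (c - a - 1) * U 0 - 2 * Y 0 := by
    have h := Complex.one_div_Gamma_eq_self_mul_one_div_Gamma_add_one (c - 1)
    rw [sub_add_cancel] at h
    simp only [hV, hU, hY, regHypergeometricTerm]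
    simp [h]
    ring
  have e1 : -((a + c - 1) * (V 1 - 2 * x * V 0)) = (c - a - 1) * (U 1 + x * U 0) - 2 * Y 1 := by
    have h := hg 0
    simp only [hV, hU, hY, regHypergeometricTerm]
    simp at h
    simp [h]
    ring
  have e2 : ∀ n, -((a + c - 1) * (V (n + 1 + 1) - 2 * x * V (n + 1) + x ^ 2 * V n)) =
      (c - a - 1) * (U (n + 1 + 1) + x * U (n + 1)) - 2 * Y (n + 1 + 1) := by
    intro n
    have h0 := hg n
    have h1 := hg (n + 1)
    have hf : (n.factorial : ℂ) ≠ 0 := by exact_mod_cast n.factorial_ne_zero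
    have hn1 : (n : ℂ) + 1 ≠ 0 := by exact_mod_cast n.succ_ne_zero
    have hn2 : (n : ℂ) + 1 + 1 ≠ 0 := by exact_mod_cast (n + 1).succ_ne_zero
    have hy : c - 1 + ((n + 1 + 1 : ℕ) : ℂ) = c + (n + 1 : ℕ) := by push_cast; ring
    have p1 : (ascPochhammer ℂ (n + 1)).eval (a + c - 1) =
        (a + c - 1) * (ascPochhammer ℂ n).eval (a + c) := by
      rw [ascPochhammer_succ_eval_left]; ring_nf
    have p2 : (ascPochhammer ℂ (n + 1 + 1)).eval (a + c - 2) =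
        (a + c - 2) * ((a + c - 1) * (ascPochhammer ℂ n).eval (a + c)) := by
      rw [ascPochhammer_succ_eval_left, show a + c - 2 + 1 = a + c - 1 by ring, p1]
    have p3 : (ascPochhammer ℂ (n + 1)).eval a = a * (ascPochhammer ℂ n).eval (a + 1) :=
      ascPochhammer_succ_eval_left n a
    simp only [hV, hU, hY, regHypergeometricTerm]
    rw [hy, p2, ascPochhammer_succ_eval (n + 1) (a + c - 1), p1, ascPochhammer_succ_eval (n + 1) a,
      p3, ascPochhammer_succ_eval (n + 1) (a + 1), ascPochhammer_succ_eval (n + 1) (a + c),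
      ascPochhammer_succ_eval n (a + 1), ascPochhammer_succ_eval n (a + c), h0, h1,
      Nat.factorial_succ (n + 1), Nat.factorial_succ n]
    push_cast
    generalize (Complex.Gamma (c + ((n : ℂ) + 1 + 1)))⁻¹ = g
    generalize (ascPochhammer ℂ n).eval (a + 1) = P
    generalize (ascPochhammer ℂ n).eval (a + c) = R
    field_simp
    ring
  have key := tsum_congr (L := SummationFilter.unconditional ℕ) e2
  have s1V := shift sV
  have s2V := shift s1V
  have s1U := shift sU
  have s2U := shift s1U
  have s2Y := shift (shift sY)
  rw [tsum_neg, tsum_mul_left, ((s2V.sub (s1V.mul_left _)).tsum_add (sV.mul_left _)),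
    s2V.tsum_sub (s1V.mul_left _), tsum_mul_left, tsum_mul_left,
    ((s2U.add (s1U.mul_left x)).mul_left _).tsum_sub (s2Y.mul_left _), tsum_mul_left, tsum_mul_left,
    s2U.tsum_add (s1U.mul_left _), tsum_mul_left, tail s1V, tail s1U, tail (shift sY), tail sV,
    tail sU, tail sY] at key
  rw [regHypergeometric_eq_tsum, regHypergeometric_eq_tsum, regHypergeometric_eq_tsum]
  linear_combination key + e0 + e1

/-! ### The argument of the series and the branches of its powers -/

theorem Complex.arg_pos_and_lt_pi_of_im_pos {z : ℂ} (h : 0 < z.im) : 0 < z.arg ∧ z.arg < Real.pi := by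
  refine ⟨lt_of_le_of_ne (Complex.arg_nonneg_iff.2 h.le) fun h0 => ?_,
    lt_of_le_of_ne z.arg_le_pi fun h0 => ?_⟩
  · exact h.ne' (Complex.arg_eq_zero_iff.1 h0.symm).2
  · exact h.ne' (Complex.arg_eq_pi_iff.1 h0).2

/-- For `z` off the segment `[-1, 1]`, one of four cases holds. -/
theorem im_or_re_of_notMem_segment {z : ℂ} (hz : ∀ x : ℝ, -1 ≤ x → x ≤ 1 → z ≠ (x : ℂ)) :
    0 < z.im ∨ z.im < 0 ∨ (z.im = 0 ∧ 1 < z.re) ∨ (z.im = 0 ∧ z.re < -1) := by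
  rcases lt_trichotomy z.im 0 with h | h | h
  · exact .inr (.inl h)
  · by_contra! hc
    exact hz z.re (hc.2.2.2 h) (hc.2.2.1 h) (Complex.ext rfl (by simpa using h))
  · exact .inl h

theorem ne_one_of_notMem_segment {z : ℂ} (hz : ∀ x : ℝ, -1 ≤ x → x ≤ 1 → z ≠ (x : ℂ)) :
    z - 1 ≠ 0 ∧ z + 1 ≠ 0 := by
  have h1 := hz 1 (by norm_num) le_rfl
  have h2 := hz (-1) le_rfl (by norm_num)
  refine ⟨sub_ne_zero.2 (by simpa using h1), fun h => h2 ?_⟩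
  push_cast
  linear_combination h

theorem sqSubOnePow_eq_exp {z : ℂ} (h : z - 1 ≠ 0 ∧ z + 1 ≠ 0) (s : ℂ) :
    sqSubOnePow z s = Complex.exp ((Complex.log (z - 1) + Complex.log (z + 1)) * s) := by
  rw [sqSubOnePow, Complex.cpow_def_of_ne_zero h.1, Complex.cpow_def_of_ne_zero h.2,
    ← Complex.exp_add, add_mul]

theorem sqSubOnePow_half_sq {z : ℂ} (h : z - 1 ≠ 0 ∧ z + 1 ≠ 0) :
    sqSubOnePow z (1 / 2) ^ 2 = z ^ 2 - 1 := by
  rw [sqSubOnePow_eq_exp h, ← Complex.exp_nat_mul,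
    show ((2 : ℕ) : ℂ) * ((Complex.log (z - 1) + Complex.log (z + 1)) * (1 / 2)) =
      Complex.log (z - 1) + Complex.log (z + 1) by push_cast; ring,
    Complex.exp_add, Complex.exp_log h.1, Complex.exp_log h.2]
  ring

theorem add_mul_sub_sqSubOnePow {z : ℂ} (h : z - 1 ≠ 0 ∧ z + 1 ≠ 0) :
    (z + sqSubOnePow z (1 / 2)) * (z - sqSubOnePow z (1 / 2)) = 1 := by
  linear_combination -sqSubOnePow_half_sq h

theorem add_sqSubOnePow_ne_zero {z : ℂ} (h : z - 1 ≠ 0 ∧ z + 1 ≠ 0) :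
    z + sqSubOnePow z (1 / 2) ≠ 0 :=
  left_ne_zero_of_mul_eq_one (add_mul_sub_sqSubOnePow h)

theorem sqSubOnePow_ne_zero {z : ℂ} (h : z - 1 ≠ 0 ∧ z + 1 ≠ 0) (s : ℂ) : sqSubOnePow z s ≠ 0 := by
  rw [sqSubOnePow_eq_exp h]
  exact Complex.exp_ne_zero _

theorem abs_arg_add_one_sub_arg_sub_one_lt {z : ℂ}
    (hz : ∀ x : ℝ, -1 ≤ x → x ≤ 1 → z ≠ (x : ℂ)) :
    |(z + 1).arg - (z - 1).arg| < Real.pi := by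
  have hpi := Real.pi_pos
  rcases im_or_re_of_notMem_segment hz with h | h | ⟨h, h'⟩ | ⟨h, h'⟩
  · have h1 := Complex.arg_pos_and_lt_pi_of_im_pos (z := z + 1) (by simpa using h)
    have h2 := Complex.arg_pos_and_lt_pi_of_im_pos (z := z - 1) (by simpa using h)
    rw [abs_lt]; constructor <;> linarith
  · have h1 := Complex.arg_neg_iff (z := z + 1) |>.2 (by simpa using h)
    have h2 := Complex.arg_neg_iff (z := z - 1) |>.2 (by simpa using h)
    have h3 := Complex.neg_pi_lt_arg (z + 1)
    have h4 := Complex.neg_pi_lt_arg (z - 1)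
    rw [abs_lt]; constructor <;> linarith
  · rw [Complex.arg_eq_zero_iff.2 ⟨by simp; linarith, by simpa using h⟩,
      Complex.arg_eq_zero_iff.2 ⟨by simp; linarith, by simpa using h⟩]
    simpa using hpi
  · rw [Complex.arg_eq_pi_iff.2 ⟨by simp; linarith, by simpa using h⟩,
      Complex.arg_eq_pi_iff.2 ⟨by simp; linarith, by simpa using h⟩]
    simpa using hpi

/-- With `p = √(z + 1)` and `q = √(z - 1)` one has `z ± r = (p ± q)² / 2`, and `|p - q| < |p + q|`
means `Re (p q̄) > 0`. This holds because the arguments of `z + 1` and `z - 1` differ by less than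
`π`. -/
theorem norm_sub_lt_norm_add_sqSubOnePow {z : ℂ}
    (hz : ∀ x : ℝ, -1 ≤ x → x ≤ 1 → z ≠ (x : ℂ)) :
    ‖z - sqSubOnePow z (1 / 2)‖ < ‖z + sqSubOnePow z (1 / 2)‖ := by
  have h := ne_one_of_notMem_segment hz
  obtain ⟨p, hp⟩ : ∃ p, p = Complex.exp (Complex.log (z + 1) / 2) := ⟨_, rfl⟩
  obtain ⟨q, hq⟩ : ∃ q, q = Complex.exp (Complex.log (z - 1) / 2) := ⟨_, rfl⟩
  have hp2 : p ^ 2 = z + 1 := by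
    rw [hp, ← Complex.exp_nat_mul, show ((2 : ℕ) : ℂ) * (Complex.log (z + 1) / 2) =
      Complex.log (z + 1) by push_cast; ring, Complex.exp_log h.2]
  have hq2 : q ^ 2 = z - 1 := by
    rw [hq, ← Complex.exp_nat_mul, show ((2 : ℕ) : ℂ) * (Complex.log (z - 1) / 2) =
      Complex.log (z - 1) by push_cast; ring, Complex.exp_log h.1]
  have hr : sqSubOnePow z (1 / 2) = p * q := by
    rw [sqSubOnePow_eq_exp h, hp, hq, ← Complex.exp_add]
    congr 1
    ring
  have hre : 0 < (p * (starRingEnd ℂ) q).re := by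
    rw [hp, hq, ← Complex.exp_conj, ← Complex.exp_add, Complex.exp_re]
    refine mul_pos (Real.exp_pos _) (Real.cos_pos_of_mem_Ioo ?_)
    have := abs_lt.1 (abs_arg_add_one_sub_arg_sub_one_lt hz)
    have him : (Complex.log (z + 1) / 2 + (starRingEnd ℂ) (Complex.log (z - 1) / 2)).im =
        ((z + 1).arg - (z - 1).arg) / 2 := by
      rw [Complex.add_im, Complex.conj_im, Complex.div_ofNat_im, Complex.div_ofNat_im,
        Complex.log_im, Complex.log_im]
      ring
    rw [him]
    constructor <;> linarith
  have hpq : ‖p - q‖ < ‖p + q‖ := by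
    rw [← sq_lt_sq₀ (norm_nonneg _) (norm_nonneg _), Complex.sq_norm, Complex.sq_norm,
      Complex.normSq_add, Complex.normSq_sub]
    linarith
  have e1 : z - sqSubOnePow z (1 / 2) = (p - q) ^ 2 / 2 := by
    rw [hr]; linear_combination -(hp2 + hq2) / 2
  have e2 : z + sqSubOnePow z (1 / 2) = (p + q) ^ 2 / 2 := by
    rw [hr]; linear_combination -(hp2 + hq2) / 2
  rw [e1, e2, norm_div, norm_div, norm_pow, norm_pow]
  gcongr
  norm_num

theorem norm_legendreQ_argument_lt_one {z : ℂ} (hz : ∀ x : ℝ, -1 ≤ x → x ≤ 1 → z ≠ (x : ℂ)) :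
    ‖(z - sqSubOnePow z (1 / 2)) / (z + sqSubOnePow z (1 / 2))‖ < 1 := by
  have h := norm_sub_lt_norm_add_sqSubOnePow hz
  rw [norm_div, div_lt_one ((norm_nonneg _).trans_lt h)]
  exact h

theorem one_lt_normSq_add_sqSubOnePow {z : ℂ} (hz : ∀ x : ℝ, -1 ≤ x → x ≤ 1 → z ≠ (x : ℂ)) :
    1 < Complex.normSq (z + sqSubOnePow z (1 / 2)) := by
  have h := norm_sub_lt_norm_add_sqSubOnePow hz
  have h1 := congrArg norm (add_mul_sub_sqSubOnePow (ne_one_of_notMem_segment hz))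
  rw [norm_mul, norm_one] at h1
  rw [← Complex.sq_norm]
  nlinarith [mul_pos ((norm_nonneg _).trans_lt h) (sub_pos.2 h)]

/-- For `w = z + r` the identity `1 - w⁻² = 2r/w` holds also for principal logarithms, which is what
makes complex powers of it split. The point is that the imaginary part on the right stays in `(-π,
π]`: from `2z = w + w⁻¹` and `|w| > 1`, `w` lies in the same open half plane, or on the same real
half-line, as `z`. -/
theorem log_one_sub_legendreQ_argument {z : ℂ} (hz : ∀ x : ℝ, -1 ≤ x → x ≤ 1 → z ≠ (x : ℂ)) :
    Complex.log (1 - (z - sqSubOnePow z (1 / 2)) / (z + sqSubOnePow z (1 / 2))) =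
      Complex.log 2 + (Complex.log (z - 1) + Complex.log (z + 1)) * (1 / 2) -
        Complex.log (z + sqSubOnePow z (1 / 2)) := by
  have h := ne_one_of_notMem_segment hz
  have hn := one_lt_normSq_add_sqSubOnePow hz
  have hw0 := add_sqSubOnePow_ne_zero h
  have hinv : z - sqSubOnePow z (1 / 2) = (z + sqSubOnePow z (1 / 2))⁻¹ :=
    eq_inv_of_mul_eq_one_right (add_mul_sub_sqSubOnePow h)
  have hexp : 1 - (z - sqSubOnePow z (1 / 2)) / (z + sqSubOnePow z (1 / 2)) =
      Complex.exp (Complex.log 2 + (Complex.log (z - 1) + Complex.log (z + 1)) * (1 / 2) -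
        Complex.log (z + sqSubOnePow z (1 / 2))) := by
    rw [Complex.exp_sub, Complex.exp_add, Complex.exp_log two_ne_zero, Complex.exp_log hw0,
      ← sqSubOnePow_eq_exp h]
    field_simp
    ring
  rw [hexp]
  have hzw : 2 * z = (z + sqSubOnePow z (1 / 2)) + (z + sqSubOnePow z (1 / 2))⁻¹ := by
    rw [← hinv]; ring
  generalize hw : z + sqSubOnePow z (1 / 2) = w at *
  have him : 2 * z.im = w.im * (1 - (Complex.normSq w)⁻¹) := by
    have := congrArg Complex.im hzw
    simp [Complex.inv_im] at this
    rw [this]; ring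
  have hre : 2 * z.re = w.re * (1 + (Complex.normSq w)⁻¹) := by
    have := congrArg Complex.re hzw
    simp [Complex.inv_re] at this
    rw [this]; ring
  have hlt : 0 < 1 - (Complex.normSq w)⁻¹ := sub_pos.2 (inv_lt_one_of_one_lt₀ hn)
  have hgt : 0 < 1 + (Complex.normSq w)⁻¹ := by positivity
  have key : -Real.pi < ((z - 1).arg + (z + 1).arg) / 2 - w.arg ∧
      ((z - 1).arg + (z + 1).arg) / 2 - w.arg ≤ Real.pi := by
    have hpi := Real.pi_pos
    rcases im_or_re_of_notMem_segment hz with h | h | ⟨h, h'⟩ | ⟨h, h'⟩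
    · have h1 := Complex.arg_pos_and_lt_pi_of_im_pos (z := z + 1) (by simpa using h)
      have h2 := Complex.arg_pos_and_lt_pi_of_im_pos (z := z - 1) (by simpa using h)
      have h3 := Complex.arg_pos_and_lt_pi_of_im_pos (z := w)
        (pos_of_mul_pos_left (him ▸ by linarith) hlt.le)
      constructor <;> linarith
    · have h1 := Complex.arg_neg_iff (z := z + 1) |>.2 (by simpa using h)
      have h2 := Complex.arg_neg_iff (z := z - 1) |>.2 (by simpa using h)
      have h3 := Complex.neg_pi_lt_arg (z + 1)
      have h4 := Complex.neg_pi_lt_arg (z - 1)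
      have h5 := Complex.neg_pi_lt_arg w
      have h6 := Complex.arg_neg_iff (z := w) |>.2 (by
        by_contra! hc
        nlinarith [mul_nonneg hc hlt.le])
      constructor <;> linarith
    · have hw1 : w.im = 0 := by
        rw [h, mul_zero] at him
        exact (mul_eq_zero.1 him.symm).resolve_right hlt.ne'
      have hw2 : 0 ≤ w.re := by
        by_contra! hc
        nlinarith [mul_pos (neg_pos.2 hc) hgt]
      rw [Complex.arg_eq_zero_iff.2 ⟨by simp; linarith, by simpa using h⟩,
        Complex.arg_eq_zero_iff.2 ⟨by simp; linarith, by simpa using h⟩,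
        Complex.arg_eq_zero_iff.2 ⟨hw2, hw1⟩]
      constructor <;> linarith
    · have hw1 : w.im = 0 := by
        rw [h, mul_zero] at him
        exact (mul_eq_zero.1 him.symm).resolve_right hlt.ne'
      have hw2 : w.re < 0 := by
        by_contra! hc
        nlinarith [mul_nonneg hc hgt.le]
      rw [Complex.arg_eq_pi_iff.2 ⟨by simp; linarith, by simpa using h⟩,
        Complex.arg_eq_pi_iff.2 ⟨by simp; linarith, by simpa using h⟩,
        Complex.arg_eq_pi_iff.2 ⟨hw2, hw1⟩]
      constructor <;> linarith
  have hl2 : (Complex.log 2).im = 0 := by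
    rw [Complex.log_im]
    exact Complex.arg_eq_zero_iff.2 ⟨by norm_num, by norm_num⟩
  have hY : (Complex.log 2 + (Complex.log (z - 1) + Complex.log (z + 1)) * (1 / 2) -
      Complex.log w).im = ((z - 1).arg + (z + 1).arg) / 2 - w.arg := by
    rw [Complex.sub_im, Complex.add_im, hl2, show (Complex.log (z - 1) + Complex.log (z + 1)) *
      (1 / 2) = ((1 / 2 : ℝ) : ℂ) * (Complex.log (z - 1) + Complex.log (z + 1)) by push_cast; ring,
      Complex.im_ofReal_mul, Complex.add_im]
    simp only [Complex.log_im]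
    ring
  exact Complex.log_exp (hY ▸ key.1) (hY ▸ key.2)

/-! ### The reduced function: analyticity and evenness in the order -/

/-- The Legendre function of the second kind without its factor `e^{iπμ} Γ(ν + μ + 1)`; it is entire
and even in `μ`. -/
noncomputable def legendreQReduced (ν μ z : ℂ) : ℂ :=
  (Real.sqrt Real.pi : ℂ) * (2 : ℂ) ^ μ * sqSubOnePow z (μ / 2) *
    (z + sqSubOnePow z (1 / 2)) ^ (-(ν + μ + 1)) *
    regHypergeometric (μ + 1 / 2) (ν + μ + 1) (ν + 3 / 2)
      ((z - sqSubOnePow z (1 / 2)) / (z + sqSubOnePow z (1 / 2)))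

theorem legendreQ_eq_mul_legendreQReduced (ν μ z : ℂ) :
    legendreQ ν μ z = Complex.exp (Complex.I * Real.pi * μ) * Complex.Gamma (ν + μ + 1) *
      legendreQReduced ν μ z := by
  rw [legendreQ, legendreQReduced]
  ring

theorem differentiable_legendreQReduced {z : ℂ} (hz : ∀ x : ℝ, -1 ≤ x → x ≤ 1 → z ≠ (x : ℂ))
    (ν : ℂ) : Differentiable ℂ fun μ => legendreQReduced ν μ z := by
  have h := ne_one_of_notMem_segment hz
  have hF := differentiable_regHypergeometric_add (1 / 2) (ν + 1) (ν + 3 / 2)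
    (norm_legendreQ_argument_lt_one hz)
  have h2 : Differentiable ℂ fun μ : ℂ => (2 : ℂ) ^ μ := fun μ =>
    differentiableAt_id.const_cpow (.inl two_ne_zero)
  have h3 : Differentiable ℂ fun μ : ℂ => sqSubOnePow z (μ / 2) := by
    simp only [sqSubOnePow_eq_exp h]
    fun_prop
  have h4 : Differentiable ℂ fun μ : ℂ => (z + sqSubOnePow z (1 / 2)) ^ (-(ν + μ + 1)) := fun μ =>
    DifferentiableAt.const_cpow (by fun_prop) (.inl (add_sqSubOnePow_ne_zero h))
  have := (((h2.const_mul (Real.sqrt Real.pi : ℂ)).mul h3).mul h4).mul hF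
  have he : (fun μ => legendreQReduced ν μ z) = _ := funext fun μ => by
    rw [legendreQReduced, show ν + μ + 1 = μ + (ν + 1) by ring]
  rw [he]
  simpa only [show ∀ μ, ν + μ + 1 = μ + (ν + 1) from fun μ => by ring] using! this

/-- Euler's transformation sends the parameters for `μ` to those for `-μ`, exchanged, with the
factor `(1 - x)^{-2μ}`. As `1 - x = 2r/w`, this factor turns `2^μ r^μ w^{-(ν+μ+1)}` into the same
expression for `-μ`. -/
theorem legendreQReduced_neg {z : ℂ} (hz : ∀ x : ℝ, -1 ≤ x → x ≤ 1 → z ≠ (x : ℂ)) (ν μ : ℂ) :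
    legendreQReduced ν (-μ) z = legendreQReduced ν μ z := by
  have h := ne_one_of_notMem_segment hz
  have hx := norm_legendreQ_argument_lt_one hz
  have hlog := log_one_sub_legendreQ_argument hz
  have hx0 : 1 - (z - sqSubOnePow z (1 / 2)) / (z + sqSubOnePow z (1 / 2)) ≠ 0 := by
    intro h0
    rw [← sub_eq_zero.1 h0, norm_one] at hx
    exact lt_irrefl _ hx
  rw [legendreQReduced, legendreQReduced,
    regHypergeometric_euler (μ + 1 / 2) (ν + μ + 1) (ν + 3 / 2) hx,
    regHypergeometric_swap (-μ + 1 / 2),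
    show ν + 3 / 2 - (μ + 1 / 2) = ν + -μ + 1 by ring,
    show ν + 3 / 2 - (ν + μ + 1) = -μ + 1 / 2 by ring,
    Complex.cpow_def_of_ne_zero hx0, hlog, sqSubOnePow_eq_exp h, sqSubOnePow_eq_exp h (μ / 2),
    Complex.cpow_def_of_ne_zero two_ne_zero, Complex.cpow_def_of_ne_zero two_ne_zero,
    Complex.cpow_def_of_ne_zero (add_sqSubOnePow_ne_zero h),
    Complex.cpow_def_of_ne_zero (add_sqSubOnePow_ne_zero h)]
  generalize regHypergeometric _ _ _ _ = F
  have e3 : ∀ s a b c : ℂ, s * Complex.exp a * Complex.exp b * Complex.exp c * F =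
      s * Complex.exp (a + b + c) * F := fun s a b c => by
    simp only [Complex.exp_add]; ring
  have e4 : ∀ s a b c d : ℂ, s * Complex.exp a * Complex.exp b * Complex.exp c *
      (Complex.exp d * F) = s * Complex.exp (a + b + c + d) * F := fun s a b c d => by
    simp only [Complex.exp_add]; ring
  rw [e3, e4]
  congr 3
  ring

theorem deriv_legendreQReduced_neg {z : ℂ} (hz : ∀ x : ℝ, -1 ≤ x → x ≤ 1 → z ≠ (x : ℂ)) (ν μ : ℂ) :
    deriv (fun μ => legendreQReduced ν μ z) (-μ) = -deriv (fun μ => legendreQReduced ν μ z) μ := by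
  have h := deriv_comp_neg (f := fun μ => legendreQReduced ν μ z) (x := μ)
  simp only [legendreQReduced_neg hz] at h
  rw [h, neg_neg]

theorem hasDerivAt_legendreQ {z : ℂ} (hz : ∀ x : ℝ, -1 ≤ x → x ≤ 1 → z ≠ (x : ℂ)) {ν μ : ℂ}
    (hν : ∀ n : ℕ, ν + μ + 1 ≠ -(n : ℂ)) :
    HasDerivAt (fun μ => legendreQ ν μ z)
      ((Complex.I * Real.pi + Complex.digamma (ν + μ + 1)) * legendreQ ν μ z +
        Complex.exp (Complex.I * Real.pi * μ) * Complex.Gamma (ν + μ + 1) *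
          deriv (fun μ => legendreQReduced ν μ z) μ) μ := by
  have h1 : HasDerivAt (fun μ : ℂ => Complex.exp (Complex.I * Real.pi * μ))
      (Complex.exp (Complex.I * Real.pi * μ) * (Complex.I * Real.pi * 1)) μ :=
    ((hasDerivAt_id μ).const_mul _).cexp
  have h2 : HasDerivAt (fun μ : ℂ => Complex.Gamma (ν + μ + 1))
      (deriv Complex.Gamma (ν + μ + 1)) μ := by
    have := (Complex.differentiableAt_Gamma _ hν).hasDerivAt.comp μ
      (((hasDerivAt_id μ).const_add ν).add_const 1)
    simpa [Function.comp_def] using! this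
  have h3 := (differentiable_legendreQReduced hz ν μ).hasDerivAt
  have h := (h1.fun_mul h2).fun_mul h3
  have hG : deriv Complex.Gamma (ν + μ + 1) =
      Complex.digamma (ν + μ + 1) * Complex.Gamma (ν + μ + 1) := by
    rw [Complex.digamma_def, logDeriv_apply, div_mul_cancel₀ _ (Complex.Gamma_ne_zero hν)]
  rw [hG] at h
  simp only [legendreQ_eq_mul_legendreQReduced]
  refine h.congr_deriv ?_
  ring

/-! ### The recurrence in the order -/

/-- The recurrence that raises the order of the Legendre functions of the second kind by one. -/
theorem legendreQ_order_succ {z : ℂ} (hz : ∀ x : ℝ, -1 ≤ x → x ≤ 1 → z ≠ (x : ℂ)) {ν μ : ℂ}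
    (h0 : ν + μ ≠ 0) (h1 : ν + μ + 1 ≠ 0) :
    sqSubOnePow z (1 / 2) * legendreQ ν (μ + 1) z =
      (ν - μ) * z * legendreQ ν μ z - (ν + μ) * legendreQ (ν - 1) μ z := by
  have h := ne_one_of_notMem_segment hz
  have hc := regHypergeometric_contiguous (μ + 1 / 2) (ν + 3 / 2) (norm_legendreQ_argument_lt_one hz)
  have hw0 := add_sqSubOnePow_ne_zero h
  have hinv : z - sqSubOnePow z (1 / 2) = (z + sqSubOnePow z (1 / 2))⁻¹ :=
    eq_inv_of_mul_eq_one_right (add_mul_sub_sqSubOnePow h)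
  have hG1 : Complex.Gamma (ν + (μ + 1) + 1) = (ν + μ + 1) * ((ν + μ) * Complex.Gamma (ν + μ)) := by
    rw [← Complex.Gamma_add_one _ h0, ← Complex.Gamma_add_one _ h1]
    ring_nf
  have hE : Complex.exp (Complex.I * Real.pi * (μ + 1)) = -Complex.exp (Complex.I * Real.pi * μ) := by
    rw [mul_add, mul_one, Complex.exp_add, mul_comm Complex.I, Complex.exp_pi_mul_I]
    ring
  have hS : sqSubOnePow z ((μ + 1) / 2) = sqSubOnePow z (μ / 2) * sqSubOnePow z (1 / 2) := by
    rw [sqSubOnePow_eq_exp h, sqSubOnePow_eq_exp h, sqSubOnePow_eq_exp h, ← Complex.exp_add]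
    ring_nf
  have hW1 : (z + sqSubOnePow z (1 / 2)) ^ (-(ν + (μ + 1) + 1)) =
      (z + sqSubOnePow z (1 / 2)) ^ (-(ν + μ + 1)) * (z - sqSubOnePow z (1 / 2)) := by
    rw [show -(ν + (μ + 1) + 1) = -(ν + μ + 1) - 1 by ring, Complex.cpow_sub _ _ hw0,
      Complex.cpow_one, hinv, div_eq_mul_inv]
  have hW2 : (z + sqSubOnePow z (1 / 2)) ^ (-(ν - 1 + μ + 1)) =
      (z + sqSubOnePow z (1 / 2)) ^ (-(ν + μ + 1)) * (z + sqSubOnePow z (1 / 2)) := by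
    rw [show -(ν - 1 + μ + 1) = -(ν + μ + 1) + 1 by ring, Complex.cpow_add _ _ hw0,
      Complex.cpow_one]
  have h2 : (2 : ℂ) ^ (μ + 1) = 2 ^ μ * 2 := by
    rw [Complex.cpow_add _ _ two_ne_zero, Complex.cpow_one]
  rw [show μ + 1 / 2 + (ν + 3 / 2) - 1 = ν + μ + 1 by ring,
    show μ + 1 / 2 + (ν + 3 / 2) - 2 = ν + μ by ring,
    show μ + 1 / 2 + (ν + 3 / 2) = ν + μ + 2 by ring,
    show ν + 3 / 2 - (μ + 1 / 2) - 1 = ν - μ by ring,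
    show μ + 1 / 2 + 1 = μ + 3 / 2 by ring, show ν + 3 / 2 - 1 = ν + 1 / 2 by ring] at hc
  rw [legendreQ, legendreQ, legendreQ, hG1, hE, hS, hW1, hW2, h2, Complex.Gamma_add_one _ h0,
    show ν - 1 + μ + 1 = ν + μ by ring, show ν - 1 + 3 / 2 = ν + 1 / 2 by ring,
    show μ + 1 + 1 / 2 = μ + 3 / 2 by ring, show ν + (μ + 1) + 1 = ν + μ + 2 by ring]
  have hsum : z + sqSubOnePow z (1 / 2) + (z - sqSubOnePow z (1 / 2)) = 2 * z := by ring
  have hdiff : z + sqSubOnePow z (1 / 2) - (z - sqSubOnePow z (1 / 2)) =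
    2 * sqSubOnePow z (1 / 2) := by ring
  -- In terms of `w = z + r` and `v = w⁻¹` everything is rational: `z = (w + v)/2`, `r = (w - v)/2`,
  -- `x = v²`. Then `hA` and `hB` match the factors `(1 - x)²` and `1 + x` of the contiguous
  -- relation.
  rw [hinv] at hc hsum hdiff ⊢
  generalize regHypergeometric (μ + 3 / 2) _ _ _ = F1 at *
  generalize regHypergeometric (μ + 1 / 2) (ν + μ + 1) _ _ = F2 at *
  generalize regHypergeometric (μ + 1 / 2) (ν + μ) _ _ = F3 at *
  generalize (z + sqSubOnePow z (1 / 2)) ^ (-(ν + μ + 1)) = W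
  generalize sqSubOnePow z (μ / 2) = S
  generalize z + sqSubOnePow z (1 / 2) = w at *
  generalize sqSubOnePow z (1 / 2) = r at *
  have hz' : z = (w + w⁻¹) / 2 := by rw [hsum]; ring
  have hr' : r = (w - w⁻¹) / 2 := by rw [hdiff]; ring
  rw [hz', hr']
  have hww : w⁻¹ * w = 1 := inv_mul_cancel₀ hw0
  rw [div_eq_mul_inv] at hc
  generalize w⁻¹ = v at *
  have hA : (w - v) ^ 2 * v = w * (1 - v * v) ^ 2 := by linear_combination (w - v ^ 3) * hww
  have hB : w * (1 + v * v) = w + v := by linear_combination v * hww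
  generalize Complex.exp (Complex.I * Real.pi * μ) = E
  generalize Complex.Gamma (ν + μ) = Γ
  linear_combination (E * Real.sqrt Real.pi * 2 ^ μ * (ν + μ) * Γ * S * W) * (w / 2 * hc -
    (ν + μ + 1) * F1 / 2 * hA + (ν - μ) * F2 / 2 * hB)

/-! ### The finite sum and its recurrence -/

/-- The coefficients of the finite sum in the order derivative. -/
noncomputable def orderDerivCoeff (m k : ℕ) : ℂ :=
  m.factorial * (-2 : ℂ) ^ ((m : ℤ) - k) / (2 * k.factorial * ((m : ℂ) - k))

/-- The factor `r^m` clears the half-integral powers of `z² - 1`, so that the recurrence can be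
treated as one of coefficients. -/
theorem orderDerivSum_eq {z : ℂ} (h : z - 1 ≠ 0 ∧ z + 1 ≠ 0) (m : ℕ) (ν : ℂ) :
    sqSubOnePow z (1 / 2) ^ m * orderDerivSum m ν z = ∑ k ∈ Finset.range m,
      orderDerivCoeff m k * (sqSubOnePow z (1 / 2) ^ k * legendreQ (ν + k - m - 1 / 2) k z) := by
  rw [orderDerivSum, Finset.mul_sum, Finset.mul_sum]
  refine Finset.sum_congr rfl fun k _ => ?_
  have hS : sqSubOnePow z (1 / 2) ^ m * sqSubOnePow z (((k : ℂ) - m) / 2) =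
      sqSubOnePow z (1 / 2) ^ k := by
    rw [sqSubOnePow_eq_exp h, sqSubOnePow_eq_exp h, ← Complex.exp_nat_mul, ← Complex.exp_nat_mul,
      ← Complex.exp_add]
    ring_nf
  have hP : (-1 : ℂ) ^ ((k : ℤ) - m) / 2 ^ ((k : ℤ) - m + 1) = (-2) ^ ((m : ℤ) - k) / 2 := by
    rw [show (k : ℤ) - m = -((m : ℤ) - k) by ring, zpow_add₀ two_ne_zero, zpow_neg, zpow_neg,
      show (-2 : ℂ) = (-1) * 2 by ring, mul_zpow, ← inv_zpow, show (-1 : ℂ)⁻¹ = -1 by norm_num]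
    have : (2 : ℂ) ^ ((m : ℤ) - k) ≠ 0 := zpow_ne_zero _ two_ne_zero
    simp only [zpow_one]
    field_simp
  rw [← hS, orderDerivCoeff]
  generalize (-1 : ℂ) ^ ((k : ℤ) - m) = u at *
  generalize (2 : ℂ) ^ ((k : ℤ) - m + 1) = v at *
  generalize (-2 : ℂ) ^ ((m : ℤ) - k) = t at *
  generalize sqSubOnePow z (((k : ℂ) - m) / 2) = s at *
  generalize (m : ℂ) - k = d
  linear_combination (sqSubOnePow z (1 / 2) ^ m * s *
    legendreQ (ν + k - m - 1 / 2) k z * m.factorial / (k.factorial * d)) * hP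

/-- The recurrence of the coefficients, summed against an arbitrary sequence. -/
theorem sum_orderDerivCoeff_succ (m : ℕ) (B : ℕ → ℂ) :
    ∑ k ∈ Finset.range (m + 1), orderDerivCoeff (m + 1) k * B k =
      ∑ k ∈ Finset.range m, orderDerivCoeff m k * (B (k + 1) - 2 * ((m : ℂ) - k) * B k) - B m := by
  -- For `k < m`, `e k` is `-2 (m - k)` times the coefficient. It extends to `k = m` with `e m =
  -- -1`, where that product is `0` by the convention for division by zero; hence the extra term `-B
  -- m`.
  set e : ℕ → ℂ := fun k => -(m.factorial / k.factorial * (-2 : ℂ) ^ ((m : ℤ) - k)) with he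
  have hf : ∀ k : ℕ, (k.factorial : ℂ) ≠ 0 := fun k => by exact_mod_cast k.factorial_ne_zero
  have h1 : ∀ k ∈ Finset.range (m + 1), orderDerivCoeff (m + 1) k * B k =
      e k * B k + e k * k / ((m : ℂ) + 1 - k) * B k := by
    intro k hk
    have hk' : (m : ℂ) + 1 - k ≠ 0 := by
      rw [sub_ne_zero]
      exact_mod_cast (Finset.mem_range.1 hk).ne'
    have hz : (-2 : ℂ) ^ (((m + 1 : ℕ) : ℤ) - k) = (-2) ^ ((m : ℤ) - k) * (-2) := by
      rw [← zpow_add_one₀ (by norm_num)]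
      congr 1
      push_cast
      ring
    have := hf k
    simp only [orderDerivCoeff, he, hz, Nat.factorial_succ]
    push_cast
    field_simp
    ring
  have h2 : ∀ k ∈ Finset.range m, orderDerivCoeff m k * (B (k + 1) - 2 * ((m : ℂ) - k) * B k) =
      e k * B k + e (k + 1) * (k + 1 : ℕ) / ((m : ℂ) + 1 - (k + 1 : ℕ)) * B (k + 1) := by
    intro k hk
    have hk' : (m : ℂ) - k ≠ 0 := by
      rw [sub_ne_zero]
      exact_mod_cast (Finset.mem_range.1 hk).ne'
    have hz : (-2 : ℂ) ^ ((m : ℤ) - k) = (-2) ^ ((m : ℤ) - (k + 1 : ℕ)) * (-2) := by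
      rw [← zpow_add_one₀ (by norm_num)]
      congr 1
      push_cast
      ring
    have := hf k
    have hk1 : (k : ℂ) + 1 ≠ 0 := by exact_mod_cast k.succ_ne_zero
    simp only [orderDerivCoeff, he, hz, Nat.factorial_succ]
    push_cast
    rw [show (m : ℂ) + 1 - (k + 1) = m - k by ring]
    field_simp
    ring
  have hm : e m = -1 := by simp [he, hf m]
  rw [Finset.sum_congr rfl h1, Finset.sum_congr rfl h2, Finset.sum_add_distrib,
    Finset.sum_add_distrib, Finset.sum_range_succ (fun k => e k * B k), hm,
    Finset.sum_range_succ' (fun k => e k * k / ((m : ℂ) + 1 - k) * B k)]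
  simp
  ring

theorem orderDerivSum_succ {z : ℂ} (hz : ∀ x : ℝ, -1 ≤ x → x ≤ 1 → z ≠ (x : ℂ)) (m : ℕ) {ν : ℂ}
    (hν : ∀ n : ℕ, ν - m - 1 / 2 ≠ -(n : ℂ)) :
    sqSubOnePow z (1 / 2) * orderDerivSum (m + 1) ν z =
      (ν - 1 / 2 - m) * z * orderDerivSum m ν z - (ν - 1 / 2 + m) * orderDerivSum m (ν - 1) z -
        legendreQ (ν - 1 / 2 - 1) m z := by
  have h := ne_one_of_notMem_segment hz
  have hr := pow_ne_zero m (sqSubOnePow_ne_zero h (1 / 2))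
  refine mul_left_cancel₀ hr ?_
  have e1 := orderDerivSum_eq h (m + 1) ν
  have e2 := orderDerivSum_eq h m ν
  have e3 := orderDerivSum_eq h m (ν - 1)
  set r := sqSubOnePow z (1 / 2)
  set B : ℕ → ℂ := fun k => r ^ k * legendreQ (ν - 1 / 2 - 1 + k - m) k z with hB
  have e1' : ∑ k ∈ Finset.range (m + 1), orderDerivCoeff (m + 1) k *
      (r ^ k * legendreQ (ν + k - (m + 1 : ℕ) - 1 / 2) k z) =
      ∑ k ∈ Finset.range (m + 1), orderDerivCoeff (m + 1) k * B k := by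
    refine Finset.sum_congr rfl fun k _ => ?_
    simp only [hB]
    push_cast
    rw [show ν + k - (m + 1) - 1 / 2 = ν - 1 / 2 - 1 + k - m by ring]
  have e4 : (ν - 1 / 2 - m) * z * (∑ k ∈ Finset.range m,
      orderDerivCoeff m k * (r ^ k * legendreQ (ν + k - m - 1 / 2) k z)) -
      (ν - 1 / 2 + m) * (∑ k ∈ Finset.range m,
      orderDerivCoeff m k * (r ^ k * legendreQ (ν - 1 + k - m - 1 / 2) k z)) =
      ∑ k ∈ Finset.range m, orderDerivCoeff m k * (B (k + 1) - 2 * ((m : ℂ) - k) * B k) := by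
    rw [Finset.mul_sum, Finset.mul_sum, ← Finset.sum_sub_distrib]
    refine Finset.sum_congr rfl fun k _ => ?_
    -- In each term degree minus order is `ν - m - 1/2`, independent of `k`, so the factor of `z` is
    -- the one in the recurrence. Degree plus order is `ν - m - 1/2 + 2k`, and the excess over `ν -
    -- 1/2 + m` is the `-2 (m - k)`.
    have hrec := legendreQ_order_succ hz (ν := ν + k - m - 1 / 2) (μ := k)
      (fun h0 => hν (2 * k) (by push_cast; linear_combination h0))
      (fun h0 => hν (2 * k + 1) (by push_cast; linear_combination h0))
    simp only [hB]
    push_cast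
    rw [show ν - 1 + k - m - 1 / 2 = ν - 1 / 2 - 1 + k - m by ring,
      show ν - 1 / 2 - 1 + (k + 1) - m = ν + k - m - 1 / 2 by ring]
    rw [show ν + k - m - 1 / 2 - 1 = ν - 1 / 2 - 1 + k - m by ring] at hrec
    linear_combination -(orderDerivCoeff m k * r ^ k) * hrec
  have hBm : B m = r ^ m * legendreQ (ν - 1 / 2 - 1) m z := by
    simp only [hB, add_sub_cancel_right]
  have e5 := sum_orderDerivCoeff_succ m B
  rw [e1', e5, ← e4, ← e2, ← e3, hBm] at e1
  linear_combination e1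

/-! ### The order derivatives at `m` and `-m` -/

theorem hasDerivAt_legendreQ_natCast {z : ℂ} (hz : ∀ x : ℝ, -1 ≤ x → x ≤ 1 → z ≠ (x : ℂ)) (m : ℕ) :
    ∀ ν : ℂ, (∀ n : ℕ, ν - m + 1 / 2 ≠ -(n : ℂ)) →
      HasDerivAt (fun μ : ℂ => legendreQ (ν - 1 / 2) μ z)
        ((Complex.I * Real.pi + Complex.digamma (ν - m + 1 / 2)) * legendreQ (ν - 1 / 2) m z +
            orderDerivSum m ν z) m := by
  induction m with
  | zero =>
    intro ν hν
    have h := hasDerivAt_legendreQ hz (ν := ν - 1 / 2) (μ := ((0 : ℕ) : ℂ))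
      (fun n h0 => hν n (by rw [← h0]; push_cast; ring))
    -- The derivative of an even function vanishes at `0`.
    have h0 : deriv (fun μ => legendreQReduced (ν - 1 / 2) μ z) ((0 : ℕ) : ℂ) = 0 := by
      have := deriv_legendreQReduced_neg hz (ν - 1 / 2) 0
      rw [neg_zero] at this
      rw [Nat.cast_zero]
      linear_combination this / 2
    refine h.congr_deriv ?_
    rw [h0, show ν - 1 / 2 + ((0 : ℕ) : ℂ) + 1 = ν - ((0 : ℕ) : ℂ) + 1 / 2 by push_cast; ring]
    simp [orderDerivSum]
  | succ m ih =>
    intro ν hν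
    push_cast at hν ⊢
    have hν' : ∀ n : ℕ, ν - m - 1 / 2 ≠ -(n : ℂ) := fun n h0 =>
      hν n (by rw [← h0]; ring)
    have hd := hasDerivAt_legendreQ hz (ν := ν - 1 / 2) (μ := (m : ℂ) + 1)
      (fun n h0 => hν' (n + 2 * m + 2) (by push_cast; linear_combination h0))
    have i1 := ih ν (fun n h0 => hν' (n + 1) (by push_cast; linear_combination h0))
    have i2 := ih (ν - 1) (fun n h0 => hν' n (by linear_combination h0))
    rw [show ν - 1 - m + 1 / 2 = ν - m - 1 / 2 by ring,
      show ν - 1 - 1 / 2 = ν - 1 / 2 - 1 by ring] at i2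
    -- Both induction hypotheses now carry the same digamma value; the extra `1/(ν - m - 1/2)` will
    -- cancel the `-z` from differentiating `ν - 1/2 - μ`.
    rw [show ν - m + 1 / 2 = ν - m - 1 / 2 + 1 by ring,
      Complex.digamma_apply_add_one _ hν'] at i1
    refine hd.congr_deriv ?_
    have hr := sqSubOnePow_ne_zero (ne_one_of_notMem_segment hz) (1 / 2)
    have hl := (hd.comp_add_const (m : ℂ) 1).const_mul (sqSubOnePow z (1 / 2))
    have hA : HasDerivAt (fun μ : ℂ => (ν - 1 / 2 - μ) * z) (-1 * z) m :=
      ((hasDerivAt_id (m : ℂ)).const_sub _).mul_const z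
    have hB : HasDerivAt (fun μ : ℂ => ν - 1 / 2 + μ) 1 m := (hasDerivAt_id (m : ℂ)).const_add _
    have hR := (hA.fun_mul i1).fun_sub (hB.fun_mul i2)
    -- The recurrence needs two nonvanishing conditions on `μ`; they hold at `m`, hence near it,
    -- which suffices for differentiation.
    have hev : (fun μ : ℂ => sqSubOnePow z (1 / 2) * legendreQ (ν - 1 / 2) (μ + 1) z) =ᶠ[𝓝 (m : ℂ)]
        fun μ => (ν - 1 / 2 - μ) * z * legendreQ (ν - 1 / 2) μ z -
          (ν - 1 / 2 + μ) * legendreQ (ν - 1 / 2 - 1) μ z := by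
      have c1 : ∀ᶠ μ : ℂ in 𝓝 (m : ℂ), ν - 1 / 2 + μ ≠ 0 :=
        (show Continuous fun μ : ℂ => ν - 1 / 2 + μ by fun_prop).continuousAt.eventually_ne
          (fun h0 => hν' (2 * m) (by push_cast; linear_combination h0))
      have c2 : ∀ᶠ μ : ℂ in 𝓝 (m : ℂ), ν - 1 / 2 + μ + 1 ≠ 0 :=
        (show Continuous fun μ : ℂ => ν - 1 / 2 + μ + 1 by fun_prop).continuousAt.eventually_ne
          (fun h0 => hν' (2 * m + 1) (by push_cast; linear_combination h0))
      filter_upwards [c1, c2] with μ k1 k2 using legendreQ_order_succ hz k1 k2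
    have huniq := hl.unique (hR.congr_of_eventuallyEq hev)
    refine mul_left_cancel₀ hr (huniq.trans ?_)
    have hS := orderDerivSum_succ hz m hν'
    have hQ := hev.self_of_nhds
    have hne : ν - m - 1 / 2 ≠ 0 := by simpa using hν' 0
    have hinv := mul_inv_cancel₀ hne
    rw [show ν - (m + 1) + 1 / 2 = ν - m - 1 / 2 by ring]
    linear_combination -hS - (Complex.I * Real.pi + Complex.digamma (ν - m - 1 / 2)) * hQ +
      z * legendreQ (ν - 1 / 2) m z * hinv

theorem hasDerivAt_legendreQ_neg_natCast {z : ℂ} (hz : ∀ x : ℝ, -1 ≤ x → x ≤ 1 → z ≠ (x : ℂ))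
    (m : ℕ) {ν : ℂ} (hν : ∀ n : ℕ, ν - m + 1 / 2 ≠ -(n : ℂ)) :
    HasDerivAt (fun μ : ℂ => legendreQ (ν - 1 / 2) μ z)
      (Complex.Gamma (ν - m + 1 / 2) / Complex.Gamma (ν + m + 1 / 2) *
        ((Complex.I * Real.pi + Complex.digamma (ν + m + 1 / 2)) * legendreQ (ν - 1 / 2) m z -
            orderDerivSum m ν z)) (-(m : ℂ)) := by
  have hν' : ∀ n : ℕ, ν + m + 1 / 2 ≠ -(n : ℂ) := fun n h0 =>
    hν (n + 2 * m) (by push_cast; linear_combination h0)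
  have hp := hasDerivAt_legendreQ hz (ν := ν - 1 / 2) (μ := m)
    (fun n h0 => hν' n (by linear_combination h0))
  have hn := hasDerivAt_legendreQ hz (ν := ν - 1 / 2) (μ := -(m : ℂ))
    (fun n h0 => hν n (by linear_combination h0))
  -- Two expressions for the derivative at `m`, one of them containing `R'(m)`: this determines
  -- `R'(m)`.
  have key := hp.unique (hasDerivAt_legendreQ_natCast hz m ν hν)
  refine hn.congr_deriv ?_
  have hE : Complex.exp (Complex.I * Real.pi * -(m : ℂ)) =
      Complex.exp (Complex.I * Real.pi * m) := by
    rw [show Complex.I * Real.pi * (m : ℂ) = Complex.I * Real.pi * -(m : ℂ) +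
      m * (2 * Real.pi * Complex.I) by ring, Complex.exp_add, Complex.exp_nat_mul_two_pi_mul_I,
      mul_one]
  rw [show ν - 1 / 2 + m + 1 = ν + m + 1 / 2 by ring] at key
  rw [show ν - 1 / 2 + -m + 1 = ν - m + 1 / 2 by ring, deriv_legendreQReduced_neg hz, hE]
  have hG := Complex.Gamma_ne_zero hν'
  have hQ : legendreQ (ν - 1 / 2) (-(m : ℂ)) z =
      Complex.Gamma (ν - m + 1 / 2) / Complex.Gamma (ν + m + 1 / 2) *
        legendreQ (ν - 1 / 2) m z := by
    rw [legendreQ_eq_mul_legendreQReduced, legendreQ_eq_mul_legendreQReduced,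
      legendreQReduced_neg hz, hE, show ν - 1 / 2 + -m + 1 = ν - m + 1 / 2 by ring,
      show ν - 1 / 2 + m + 1 = ν + m + 1 / 2 by ring]
    generalize Complex.Gamma (ν + m + 1 / 2) = g at *
    field_simp
  rw [hQ]
  generalize Complex.Gamma (ν + m + 1 / 2) = g at *
  have hinv := mul_inv_cancel₀ hG
  linear_combination -(Complex.Gamma (ν - m + 1 / 2) / g) * key +
    Complex.Gamma (ν - m + 1 / 2) * Complex.exp (Complex.I * Real.pi * m) *
      deriv (fun μ => legendreQReduced (ν - 1 / 2) μ z) m * hinv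

theorem mainTheorem1 (z : ℂ) (hz : ∀ x : ℝ, -1 ≤ x → x ≤ 1 → z ≠ (x : ℂ)) :
    -- the general formula, upper and lower sign
    (∀ (m : ℕ) (ν : ℂ), (∀ n : ℕ, ν - m + 1 / 2 ≠ -(n : ℂ)) →
      (DifferentiableAt ℂ (fun μ : ℂ => legendreQ (ν - 1 / 2) μ z) (m : ℂ) ∧
        Complex.Gamma (ν - m + 1 / 2) / Complex.Gamma (ν - m + 1 / 2) *
            deriv (fun μ : ℂ => legendreQ (ν - 1 / 2) μ z) (m : ℂ) =
          (Complex.I * Real.pi + Complex.digamma (ν - m + 1 / 2)) * legendreQ (ν - 1 / 2) m z +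
            orderDerivSum m ν z) ∧
      (DifferentiableAt ℂ (fun μ : ℂ => legendreQ (ν - 1 / 2) μ z) (-(m : ℂ)) ∧
        Complex.Gamma (ν + m + 1 / 2) / Complex.Gamma (ν - m + 1 / 2) *
            deriv (fun μ : ℂ => legendreQ (ν - 1 / 2) μ z) (-(m : ℂ)) =
          (Complex.I * Real.pi + Complex.digamma (ν + m + 1 / 2)) * legendreQ (ν - 1 / 2) m z -
            orderDerivSum m ν z)) ∧
    -- order `0`
    (∀ ν : ℂ, (∀ n : ℕ, ν + 1 / 2 ≠ -(n : ℂ)) →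
      HasDerivAt (fun μ : ℂ => legendreQ (ν - 1 / 2) μ z)
        ((Complex.I * Real.pi + Complex.digamma (ν + 1 / 2)) * legendreQ (ν - 1 / 2) 0 z) 0) ∧
    -- orders `-1` and `1`
    (∀ ν : ℂ, (∀ n : ℕ, ν - 1 / 2 ≠ -(n : ℂ)) →
      (DifferentiableAt ℂ (fun μ : ℂ => legendreQ (ν - 1 / 2) μ z) (-1) ∧
        (ν ^ 2 - 1 / 4) * deriv (fun μ : ℂ => legendreQ (ν - 1 / 2) μ z) (-1) =
          (Complex.I * Real.pi + Complex.digamma (ν + 3 / 2)) * legendreQ (ν - 1 / 2) 1 z +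
            sqSubOnePow z (-1 / 2) * legendreQ (ν - 3 / 2) 0 z) ∧
      HasDerivAt (fun μ : ℂ => legendreQ (ν - 1 / 2) μ z)
        ((Complex.I * Real.pi + Complex.digamma (ν - 1 / 2)) * legendreQ (ν - 1 / 2) 1 z -
          sqSubOnePow z (-1 / 2) * legendreQ (ν - 3 / 2) 0 z) 1) := by
  have general : ∀ (m : ℕ) (ν : ℂ), (∀ n : ℕ, ν - m + 1 / 2 ≠ -(n : ℂ)) →
      Complex.Gamma (ν - m + 1 / 2) ≠ 0 ∧ Complex.Gamma (ν + m + 1 / 2) ≠ 0 := fun m ν hν =>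
    ⟨Complex.Gamma_ne_zero hν, Complex.Gamma_ne_zero fun n h0 =>
      hν (n + 2 * m) (by push_cast; linear_combination h0)⟩
  refine ⟨fun m ν hν => ?_, fun ν hν => ?_, fun ν hν => ?_⟩
  · obtain ⟨g1, g2⟩ := general m ν hν
    have hp := hasDerivAt_legendreQ_natCast hz m ν hν
    have hn := hasDerivAt_legendreQ_neg_natCast hz m hν
    refine ⟨⟨hp.differentiableAt, ?_⟩, hn.differentiableAt, ?_⟩
    · rw [hp.deriv, div_self g1, one_mul]
    · rw [hn.deriv, ← mul_assoc, div_mul_div_cancel₀ g1, div_self g2, one_mul]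
  · have h := hasDerivAt_legendreQ_natCast hz 0 ν (by simpa using hν)
    simpa [orderDerivSum] using h
  · have hν1 : ∀ n : ℕ, ν - (1 : ℕ) + 1 / 2 ≠ -(n : ℂ) := fun n h0 =>
      hν n (by rw [← h0]; push_cast; ring)
    -- The single term `k = 0` carries `(-1)^{-1} / 2^0 = -1`, which reverses the signs of the
    -- general formula.
    have hS : orderDerivSum 1 ν z = -(sqSubOnePow z (-1 / 2) * legendreQ (ν - 3 / 2) 0 z) := by
      simp [orderDerivSum, show ν - 1 - 2⁻¹ = ν - 3 / 2 by ring]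
    obtain ⟨g1, -⟩ := general 1 ν hν1
    have hp := hasDerivAt_legendreQ_natCast hz 1 ν hν1
    have hn := hasDerivAt_legendreQ_neg_natCast hz 1 hν1
    rw [hS] at hp hn
    simp only [Nat.cast_one] at hp hn g1
    rw [show ν - 1 + 1 / 2 = ν - 1 / 2 by ring] at hp hn g1
    rw [show ν + 1 + 1 / 2 = ν + 3 / 2 by ring] at hn
    have hG : Complex.Gamma (ν + 3 / 2) = (ν ^ 2 - 1 / 4) * Complex.Gamma (ν - 1 / 2) := by
      have h0 : ν - 1 / 2 ≠ 0 := by simpa using hν 0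
      have h1 : ν - 1 / 2 + 1 ≠ 0 := fun h => hν 1 (by push_cast; linear_combination h)
      rw [show ν + 3 / 2 = ν - 1 / 2 + 1 + 1 by ring, Complex.Gamma_add_one _ h1,
        Complex.Gamma_add_one _ h0]
      ring
    have hne : ν ^ 2 - 1 / 4 ≠ 0 := fun h => by
      have h0 : ν - 1 / 2 ≠ 0 := by simpa using hν 0
      have h1 : ν + 1 / 2 ≠ 0 := fun h => hν 1 (by push_cast; linear_combination h)
      exact mul_ne_zero h0 h1 (by linear_combination h)
    refine ⟨⟨hn.differentiableAt, ?_⟩, hp.congr_deriv (by ring)⟩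
    rw [hn.deriv, hG, sub_neg_eq_add, div_mul_cancel_right₀ g1, mul_inv_cancel_left₀ hne]
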